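/- Let $G$ be a finite non-abelian group. The Cayley machine $\mathcal C(G)$ of $G$ is the automaton with state set $G$ and alphabet $G$ which, at state $g_0$ on input $g$, goes to state $g_0g$ and outputs $g_0g$. Each state $q$ induces a permutation $\mathcal C(G)_q$ of the set $G^*$ of finite words over $G$, sending a word to the output of the machine started at $q$, explicitly $a_1a_2\cdots a_n\mapsto (qa_1)(qa_1a_2)\cdots(qa_1a_2\cdots a_n)$. Let $\mathcal G(\mathcal C(G))$ be the automata group of the Cayley machine, i.e. the group of permutations of $G^*$ generated by all $\mathcal C(G)_q$, $q\in G$. Then, for every finite group $F$ and every torsion-free group $T$ (a group in which only the identity has finite order), $\mathcal G(\mathcal C(G))$ does not embed in the restricted wreath product $F\wr T=\big(\bigoplus_{T}F\big)\rtimes T$, where $T$ acts on $\bigoplus_T F$ by translating coordinates; that is, there is no injective group homomorphism $\mathcal G(\mathcal C(G))\to F\wr T$. -/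

import Mathlib

/-- A Mealy automaton with states `Q` and alphabet `A`: a transition function `δ : Q × A → Q` and
an output function `lam : Q × A → A`, both in curried form. (Finiteness of `Q` and `A` is imposed
where it is used.) -/
structure MealyAutomaton (Q A : Type*) where
  /-- the transition function -/
  δ : Q → A → Q
  /-- the output function -/
  lam : Q → A → A

namespace MealyAutomaton

/-- The function `A* → A*` computed by the initial automaton with start state `q`:
`q ∘ (a w) = (q ∘ a) ((q a) ∘ w)`. -/
def run {Q A : Type*} (M : MealyAutomaton Q A) : Q → List A → List A
  | _, [] => []
  | q, a :: w => M.lam q a :: run M (M.δ q a) w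

/-- An automaton is invertible if every state induces a permutation of the alphabet. -/
def Invertible {Q A : Type*} (M : MealyAutomaton Q A) : Prop :=
  ∀ q, Function.Bijective (M.lam q)

theorem Invertible.run_bijective {Q A : Type*} {M : MealyAutomaton Q A} (hM : M.Invertible)
    (q : Q) : Function.Bijective (M.run q) := by
  constructor
  · intro u
    induction u generalizing q with
    | nil => intro v h; cases v <;> simp_all [run]
    | cons a u ih =>
      intro v h
      cases v with
      | nil => simp [run] at h
      | cons b v =>
        simp only [run, List.cons.injEq] at h
        obtain rfl := (hM q).1 h.1
        rw [ih _ h.2]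
  · intro v
    induction v generalizing q with
    | nil => exact ⟨[], rfl⟩
    | cons b v ih =>
      obtain ⟨a, ha⟩ := (hM q).2 b
      obtain ⟨u, hu⟩ := ih (M.δ q a)
      exact ⟨a :: u, by simp [run, ha, hu]⟩

/-- The permutation of `A*` computed by the state `q` of an invertible automaton. -/
noncomputable def statePerm {Q A : Type*} (M : MealyAutomaton Q A) (hM : M.Invertible) (q : Q) :
    Equiv.Perm (List A) :=
  Equiv.ofBijective (M.run q) (hM.run_bijective q)

/-- The automata group generated by an invertible automaton: the group of permutations of the
rooted tree `A*` that is generated by the permutations of all of its states. -/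
def automataGroup {Q A : Type*} (M : MealyAutomaton Q A) (hM : M.Invertible) :
    Subgroup (Equiv.Perm (List A)) :=
  Subgroup.closure (Set.range (M.statePerm hM))

end MealyAutomaton

/-- The Cayley machine of a group `G`: states and alphabet are `G`, and at state `g₀` on input `g`
it goes to state `g₀ g` and outputs `g₀ g`. -/
def cayleyMachine (G : Type*) [Group G] : MealyAutomaton G G where
  δ g₀ g := g₀ * g
  lam g₀ g := g₀ * g

theorem cayleyMachine_invertible (G : Type*) [Group G] : (cayleyMachine G).Invertible :=
  fun g => Group.mulLeft_bijective g

/-- The automata group generated by the Cayley machine of `G`. -/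
def cayleyAutomataGroup (G : Type*) [Group G] : Subgroup (Equiv.Perm (List G)) :=
  (cayleyMachine G).automataGroup (cayleyMachine_invertible G)

/-- The restricted wreath product of `F` with `T`, that is `(⨁_T F) ⋊ T` with `T` acting by
translation of the coordinates: the elements `(f, t)` of the unrestricted regular wreath product
`(T → F) ⋊ T` whose `f` is trivial at all but finitely many places. -/
def restrictedWreathProduct (F T : Type*) [Group F] [Group T] :
    Subgroup (RegularWreathProduct F T) where
  carrier := {w | (Function.mulSupport w.left).Finite}
  one_mem' := by simp
  mul_mem' := by
    intro a b ha hb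
    refine (ha.union (hb.preimage (f := fun x => a.right⁻¹ * x)
      (mul_right_injective _).injOn)).subset ?_
    exact Function.mulSupport_mul _ _
  inv_mem' := by
    intro a ha
    refine (ha.preimage (f := fun x => a.right * x) (mul_right_injective _).injOn).subset ?_
    intro x hx
    simpa using hx

/-! Write `s` for the permutation of state `1` and `L q` for letterwise left multiplication by `q`.
State `q` acts as `L q * s`, so the automata group contains every `L q`, which is torsion, and `s`,
which has infinite order. As `s` fixes one-letter words, every conjugate of `L b` by a power of `s`
still acts on them as multiplication by `b`, so it never commutes with `L a` when `a` and `b` do not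
commute. In the wreath product, torsion elements lie in the base and the base is torsion. So the
image of `s` translates with infinite order, and some power of it moves one finite support off
another, forcing such a commutation. -/

namespace MealyAutomaton

variable {G : Type*} [Group G]

theorem run_cayleyMachine_eq_map (q r : G) (w : List G) :
    (cayleyMachine G).run (q * r) w = ((cayleyMachine G).run r w).map (q * ·) := by
  induction w generalizing r with
  | nil => rfl
  | cons a w ih =>
    simp only [run, cayleyMachine, List.map_cons, mul_assoc] at ih ⊢
    rw [ih]

theorem run_cayleyMachine_one_replicate (n : ℕ) :
    (cayleyMachine G).run 1 (List.replicate n 1) = List.replicate n 1 := by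
  induction n with
  | zero => rfl
  | succ n ih => simpa [run, cayleyMachine, List.replicate_succ] using ih

/-- Taking a preimage under a state of the Cayley machine moves the last nontrivial letter of a
word by one place to the right. -/
theorem eq_append_of_run_cayleyMachine_eq {u : List G} {h : G} (hh : h ≠ 1) {n : ℕ} {q : G}
    {w : List G}
    (hw : (cayleyMachine G).run q w = u ++ h :: List.replicate (n + 1) 1) :
    ∃ (v : List G) (k : G), k ≠ 1 ∧ v.length = u.length + 1 ∧
      w = v ++ k :: List.replicate n 1 := by
  induction u generalizing q w with
  | nil =>
    match w, hw with
    | a :: b :: w, hw =>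
      simp only [run, cayleyMachine, List.nil_append, List.replicate_succ,
        List.cons.injEq] at hw
      -- The state reached is always the last output. After the output `h`, an output `1` forces the
      -- input `h⁻¹ ≠ 1`; the machine is then in state `1`, where only ones give ones.
      obtain ⟨rfl, hb, hw⟩ := hw
      rw [hb] at hw
      refine ⟨[a], b, ?_, rfl, ?_⟩
      · rintro rfl
        exact hh (by simpa using hb)
      · rw [((cayleyMachine_invertible G).run_bijective 1).1
          (hw.trans (run_cayleyMachine_one_replicate n).symm)]
        rfl
    | [a], hw => simp [run] at hw
    | [], hw => simp [run] at hw
  | cons x u ih =>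
    match w, hw with
    | a :: w, hw =>
      rw [run, List.cons_append, List.cons.injEq] at hw
      obtain ⟨v, k, hk, hv, rfl⟩ := ih hw.2
      exact ⟨a :: v, k, hk, by simp [hv], rfl⟩
    | [], hw => simp [run] at hw

theorem eq_append_of_statePerm_pow_eq {g : G} (hg : g ≠ 1) {m : ℕ} (k : ℕ) (hk : k ≤ m)
    {w : List G}
    (hw : (((cayleyMachine G).statePerm (cayleyMachine_invertible G) 1) ^ k) w =
      g :: List.replicate m 1) :
    ∃ (v : List G) (h : G), h ≠ 1 ∧ v.length = k ∧ w = v ++ h :: List.replicate (m - k) 1 := by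
  induction k generalizing w with
  | zero => exact ⟨[], g, hg, rfl, by simpa using hw⟩
  | succ k ih =>
    rw [pow_succ, Equiv.Perm.mul_apply] at hw
    obtain ⟨v, h, hh, hv, e⟩ := ih (by omega) hw
    rw [show m - k = m - (k + 1) + 1 by omega] at e
    obtain ⟨v', h', hh', hv', e'⟩ := eq_append_of_run_cayleyMachine_eq hh e
    exact ⟨v', h', hh', by omega, e'⟩

theorem not_isOfFinOrder_statePerm_cayleyMachine_one [Nontrivial G] :
    ¬ IsOfFinOrder ((cayleyMachine G).statePerm (cayleyMachine_invertible G) 1) := by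
  rw [isOfFinOrder_iff_pow_eq_one]
  rintro ⟨m, hm, h⟩
  obtain ⟨g, hg⟩ := exists_ne (1 : G)
  obtain ⟨v, k, hk, -, e⟩ := eq_append_of_statePerm_pow_eq hg (m := m) m le_rfl
    (w := g :: List.replicate m 1) (by rw [h]; rfl)
  obtain ⟨m, rfl⟩ := Nat.exists_eq_add_one.2 hm
  -- The left side ends in `1` because `m > 0`, the right side in `k ≠ 1`.
  have := congrArg List.getLast? e
  rw [List.replicate_succ'] at this
  simp [← List.cons_append, - List.cons_append_fun] at this
  exact hk this.symm

/-- Letterwise left multiplication on words over a group. -/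
def leftMulPerm (G : Type*) [Group G] : G →* Equiv.Perm (List G) :=
  MonoidHom.toHomPerm
    { toFun := fun q w => w.map (q * ·)
      map_one' := by
        funext w
        simp [Function.End.one_def]
      map_mul' := fun p q => by
        funext w
        change _ = (w.map (q * ·)).map (p * ·)
        simp [mul_assoc] }

theorem leftMulPerm_apply (q : G) (w : List G) : leftMulPerm G q w = w.map (q * ·) := rfl

theorem statePerm_cayleyMachine (q : G) :
    (cayleyMachine G).statePerm (cayleyMachine_invertible G) q =
      leftMulPerm G q * (cayleyMachine G).statePerm (cayleyMachine_invertible G) 1 := by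
  ext1 w
  have := run_cayleyMachine_eq_map q 1 w
  rwa [mul_one] at this

theorem statePerm_mem_cayleyAutomataGroup (q : G) :
    (cayleyMachine G).statePerm (cayleyMachine_invertible G) q ∈ cayleyAutomataGroup G :=
  Subgroup.subset_closure ⟨q, rfl⟩

theorem leftMulPerm_mem_cayleyAutomataGroup (q : G) :
    leftMulPerm G q ∈ cayleyAutomataGroup G := by
  rw [eq_mul_inv_of_mul_eq (statePerm_cayleyMachine q).symm]
  exact mul_mem (statePerm_mem_cayleyAutomataGroup q)
    (inv_mem (statePerm_mem_cayleyAutomataGroup 1))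

theorem statePerm_cayleyMachine_one_pow_singleton (n : ℕ) (x : G) :
    (((cayleyMachine G).statePerm (cayleyMachine_invertible G) 1) ^ n) [x] = [x] := by
  induction n with
  | zero => rfl
  | succ n ih =>
    rw [pow_succ, Equiv.Perm.mul_apply]
    have : (cayleyMachine G).statePerm (cayleyMachine_invertible G) 1 [x] = [x] := by
      simp [statePerm, run, cayleyMachine]
    rw [this, ih]

theorem conj_leftMulPerm_singleton (n : ℕ) (q x : G) :
    ((cayleyMachine G).statePerm (cayleyMachine_invertible G) 1 ^ n * leftMulPerm G q *
      ((cayleyMachine G).statePerm (cayleyMachine_invertible G) 1 ^ n)⁻¹) [x] = [q * x] := by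
  have : ((cayleyMachine G).statePerm (cayleyMachine_invertible G) 1 ^ n)⁻¹ [x] = [x] := by
    rw [Equiv.Perm.inv_eq_iff_eq, statePerm_cayleyMachine_one_pow_singleton]
  rw [Equiv.Perm.mul_apply, Equiv.Perm.mul_apply, this, leftMulPerm_apply, List.map_singleton,
    statePerm_cayleyMachine_one_pow_singleton]

end MealyAutomaton

namespace RegularWreathProduct

variable {F T : Type*} [Group F] [Group T]

theorem right_eq_one_of_isOfFinOrder (hT : ∀ t : T, IsOfFinOrder t → t = 1)
    {w : RegularWreathProduct F T} (hw : IsOfFinOrder w) : w.right = 1 :=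
  hT _ ((rightHom (D := F) (Q := T)).isOfFinOrder hw)

theorem right_pow (w : RegularWreathProduct F T) (n : ℕ) : (w ^ n).right = w.right ^ n :=
  map_pow (rightHom (D := F) (Q := T)) w n

theorem left_pow_of_right_eq_one {w : RegularWreathProduct F T} (hw : w.right = 1) (n : ℕ) :
    (w ^ n).left = w.left ^ n := by
  induction n with
  | zero => simp
  | succ n ih =>
    ext x
    simp [pow_succ, ih, right_pow, hw]

theorem isOfFinOrder_of_right_eq_one [Finite F] {w : RegularWreathProduct F T}
    (hw : w.right = 1) : IsOfFinOrder w := by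
  refine isOfFinOrder_iff_pow_eq_one.2 ⟨Nat.card F, Nat.card_pos, ?_⟩
  ext x
  · simp [left_pow_of_right_eq_one hw]
  · simp [right_pow, hw]

theorem commute_of_disjoint_mulSupport {a b : RegularWreathProduct F T} (ha : a.right = 1)
    (hb : b.right = 1) (h : Disjoint (Function.mulSupport a.left) (Function.mulSupport b.left)) :
    Commute a b := by
  ext x
  · simp only [mul_left, ha, hb, Pi.mul_apply, inv_one, one_mul]
    by_cases hx : a.left x = 1
    · simp [hx]
    · have : b.left x = 1 := by
        by_contra hbx
        exact Set.disjoint_left.1 h hx hbx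
      simp [this]
  · simp [ha, hb]

theorem left_conj_apply {a : RegularWreathProduct F T} (ha : a.right = 1)
    (c : RegularWreathProduct F T) (x : T) :
    (c * a * c⁻¹).left x = c.left x * a.left (c.right⁻¹ * x) * (c.left x)⁻¹ := by
  simp [ha]

/-- Elements of the base with finite support commute with suitable conjugates of one another by
powers of an element whose translation part has infinite order. -/
theorem exists_commute_conj_pow {a b c : RegularWreathProduct F T} (ha : a.right = 1)
    (hb : b.right = 1) (ha' : (Function.mulSupport a.left).Finite)
    (hb' : (Function.mulSupport b.left).Finite) (hc : ¬ IsOfFinOrder c.right) :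
    ∃ n : ℕ, Commute a (c ^ n * b * (c ^ n)⁻¹) := by
  have hinj : Function.Injective fun n : ℕ => c.right ^ n :=
    injective_pow_iff_not_isOfFinOrder.2 hc
  -- The supports can meet only if `c.right ^ n = x * y⁻¹` with `x`, `y` in the supports of `a`,
  -- `b`; this excludes finitely many `n`.
  have hfin := ((ha'.prod hb').image fun p : T × T => p.1 * p.2⁻¹).preimage hinj.injOn
  obtain ⟨n, hn⟩ := hfin.exists_notMem
  refine ⟨n, commute_of_disjoint_mulSupport ha (by simp [hb]) ?_⟩
  refine Set.disjoint_left.2 fun x hx hx' => hn ⟨(x, (c ^ n).right⁻¹ * x), ⟨hx, ?_⟩, ?_⟩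
  · intro h
    refine hx' ?_
    simp [left_conj_apply hb, h]
  · simp [right_pow]

end RegularWreathProduct

open MealyAutomaton RegularWreathProduct in
/-- For a finite non-abelian group `G`, the automata group of its Cayley machine does not embed in
the restricted wreath product of a finite group `F` with a torsion-free group `T`. -/
theorem theorem3 {G : Type*} [Group G] [Finite G] (hG : ¬ ∀ a b : G, a * b = b * a)
    {F : Type*} [Group F] [Finite F]
    {T : Type*} [Group T] (hT : ∀ t : T, IsOfFinOrder t → t = 1) :
    ¬ ∃ φ : cayleyAutomataGroup G →* restrictedWreathProduct F T, Function.Injective φ := by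
  rintro ⟨φ, hφ⟩
  push Not at hG
  obtain ⟨a, b, hab⟩ := hG
  have : Nontrivial G := ⟨_, _, hab⟩
  let L (q : G) : cayleyAutomataGroup G := ⟨leftMulPerm G q, leftMulPerm_mem_cayleyAutomataGroup q⟩
  let c : cayleyAutomataGroup G := ⟨_, statePerm_mem_cayleyAutomataGroup 1⟩
  have hL (q : G) : (φ (L q) : RegularWreathProduct F T).right = 1 := by
    refine right_eq_one_of_isOfFinOrder hT ?_
    have h : IsOfFinOrder (L q) :=
      Submonoid.isOfFinOrder_coe.1 ((leftMulPerm G).isOfFinOrder (isOfFinOrder_of_finite q))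
    exact Submonoid.isOfFinOrder_coe.2 (φ.isOfFinOrder h)
  have hc : ¬ IsOfFinOrder (φ c : RegularWreathProduct F T).right := fun h =>
    not_isOfFinOrder_statePerm_cayleyMachine_one (Submonoid.isOfFinOrder_coe.2
      (hφ.isOfFinOrder_iff.1 (Submonoid.isOfFinOrder_coe.1
        (isOfFinOrder_of_right_eq_one (hT _ h)))))
  obtain ⟨n, hn⟩ := exists_commute_conj_pow (hL a) (hL b) (φ (L a)).2 (φ (L b)).2 hc
  have hcomm : L a * (c ^ n * L b * (c ^ n)⁻¹) = c ^ n * L b * (c ^ n)⁻¹ * L a := by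
    apply hφ
    ext1
    simpa using hn.eq
  -- On the word `[1]` the two sides give `[a * b]` and `[b * a]`.
  have h := congrArg (fun p : cayleyAutomataGroup G => (p : Equiv.Perm (List G)) [1]) hcomm
  have hL1 (x : G) : leftMulPerm G a [x] = [a * x] := rfl
  simp only [L, c, Subgroup.coe_mul, Subgroup.coe_inv, Subgroup.coe_pow,
    Equiv.Perm.mul_apply _ (leftMulPerm G a), Equiv.Perm.mul_apply (leftMulPerm G a),
    conj_leftMulPerm_singleton, hL1, mul_one, List.cons.injEq, and_true] at h
  exact hab h
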